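/- **Setting.** Fix $d\in\mathbb N$ and constants $L,\sigma_0,C_w\in\mathbb R$, $\delta\in(0,1)$, $0\le\varepsilon_0<\varepsilon<\tfrac12$, $c>0$, a sequence $\tau_w(k_0)\to0$ as $k_0\to\infty$, and a function $\rho(n,m)\to0$ as $n,m\to\infty$. For sizes $n,m\in\mathbb N$, $k_0\ge1$ consider any decentralized problem as follows. * *Loss.* $P$ is a probability law of samples; $\ell(\theta;s)$, $\theta\in\mathbb R^d$, is measurable in $s$ and continuously differentiable in $\theta$; for $P$-almost every $s$, $\|\nabla\ell(x;s)-\nabla\ell(y;s)\|\le L\|x-y\|$ for all $x,y$; and for every $\theta$, $\nabla\ell(\theta;\cdot)\in L^2(P)$ with $\mathbb E_{s\sim P}\|\nabla\ell(\theta;s)-\mathbb E_{s\sim P}\nabla\ell(\theta;s)\|^2\le\sigma_0^2$. * *Network.* An undirected graph on $m$ nodes with a set $\mathcal G$ of normal nodes (the others are Byzantine). $\mathcal N_j$ is the neighbourhood of $j$, including $j$; $\mathcal G_j=\mathcal N_j\cap\mathcal G$ and $\mathcal B_j=\mathcal N_j\setminus\mathcal G$. A node $i\in\mathcal G$ is fixed.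 For every $j\in\mathcal G_i$, $|\mathcal B_j|\le\varepsilon_0|\mathcal N_j|$. Moreover $$\sum_{j\in\mathcal G_i}\min\Bigl\{\frac{|\mathcal N_j|}{n},\,e^{-c|\mathcal N_j|}\Bigr\}\le\rho(n,m).$$ (The left side tends to zero, for instance, if $|\mathcal G_i|\log n/n\to0$, or if $|\mathcal G_i|e^{-c\min_{j\in\mathcal G_i}|\mathcal N_j|}\to0$.) * *Warm-up (Condition 2).* The outputs $\theta_{j,0}$ of $k_0$ warm-up iterations satisfy, with probability at least $1-\tau_w(k_0)$, $\sum_{j\in\mathcal G}\|\theta_{j,0}-\bar\theta_0\|^2\le C_w/k_0^{1-\delta}$, where $\bar\theta_0=|\mathcal G|^{-1}\sum_{j\in\mathcal G}\theta_{j,0}$. * *Splitting.* Each normal node $j$ has an identification set of $n$ samples, split at random; the first half $\xi_j^{(1)}$ has $\lfloor n/2\rfloor$ elements. The identification samples of all normal nodes are i.i.d. with law $P$ and independent of the pair consisting of the warm-up outputs and the splits of the normal nodes. * *Messages.* Each normal node $j$ sends its first-half gradient $\mathbf g_j=|\xi_j^{(1)}|^{-1}\sum_{s\in\xi_j^{(1)}}\nabla\ell(\theta_{j,0};s)$;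 Byzantine nodes send arbitrary vectors, also denoted $\mathbf g_j$. * *Robust mean.* For $j\in\mathcal G_i$, $\widehat{\mathbf g}_j$ is obtained from $\{\mathbf g_{j'}\}_{j'\in\mathcal N_j}$ by one of two estimators, the same for all $j$: the coordinate-wise median, or Filtering with contamination level $\varepsilon$, that is $\widehat{\mathbf g}_j=\sum_{j'\in\mathcal N_j}w_{j'}\mathbf g_{j'}$, where $w$ minimizes $\bigl\|\sum_{j'}w_{j'}(\mathbf g_{j'}-\mu_w)(\mathbf g_{j'}-\mu_w)^\top\bigr\|_{\mathrm{op}}$, $\mu_w=\sum_{j'}w_{j'}\mathbf g_{j'}$, over all weights with $0\le w_{j'}\le\frac1{(1-\varepsilon)|\mathcal N_j|}$ and $\sum_{j'}w_{j'}=1$. **Proposition.** Let $\mathbf g_j^*=\mathbb E_{s\sim P}[\nabla\ell(\theta;s)]\big|_{\theta=\theta_{j,0}}$. For each of the two estimators there are a constant $C>0$ and functions $\delta_{\mathbf g}(n,m,k_0)$ and $\tau_{\mathbf g}(n,m,k_0)$, depending only on the estimator and on $d,L,\sigma_0,C_w,\delta,\varepsilon_0,\varepsilon,c,\tau_w,\rho$,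 both tending to $0$ as $n,m,k_0\to\infty$, such that for all sizes $n,m,k_0$ and every such problem $$\sup_{j\in\mathcal G_i}\|\widehat{\mathbf g}_j-\mathbf g_j^*\|\le C\,\delta_{\mathbf g}(n,m,k_0)\quad\text{with probability at least }1-\tau_{\mathbf g}(n,m,k_0).$$ -/

import Mathlib

open MeasureTheory ProbabilityTheory Filter Topology

/-- The parameter space `ℝ^d` with its Euclidean norm. -/
abbrev ParamSpace (d : ℕ) : Type := EuclideanSpace ℝ (Fin d)

/-! ### Loss function and gradients -/

/-- The sample gradient `∇ℓ(θ; s)` (gradient in the parameter). -/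
noncomputable def lossGrad {d : ℕ} {X : Type*} (ℓ : ParamSpace d → X → ℝ)
    (θ : ParamSpace d) (s : X) : ParamSpace d :=
  gradient (fun x => ℓ x s) θ

/-- The population gradient `E_{s ∼ P} ∇ℓ(θ; s)`. -/
noncomputable def meanGrad {d : ℕ} {X : Type*} [MeasurableSpace X]
    (ℓ : ParamSpace d → X → ℝ) (P : Measure X) (θ : ParamSpace d) : ParamSpace d :=
  ∫ s, lossGrad ℓ θ s ∂P

/-- The loss is continuously differentiable in the parameter, its gradient is `P`-almost surely
`L`-Lipschitz, and the sample gradient under `P` has variance at most `σ₀²` at every parameter. -/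
structure RegularLoss {d : ℕ} {X : Type*} [MeasurableSpace X]
    (ℓ : ParamSpace d → X → ℝ) (P : Measure X) (L σ₀ : ℝ) : Prop where
  measurable : ∀ θ, Measurable (ℓ θ)
  contDiff : ∀ s, ContDiff ℝ 1 (fun θ => ℓ θ s)
  lipschitz : ∀ᵐ s ∂P, ∀ x y, ‖lossGrad ℓ x s - lossGrad ℓ y s‖ ≤ L * ‖x - y‖
  memLp : ∀ θ, MemLp (lossGrad ℓ θ) 2 P
  variance_le : ∀ θ, ∫ s, ‖lossGrad ℓ θ s - meanGrad ℓ P θ‖ ^ 2 ∂P ≤ σ₀ ^ 2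

/-- The stochastic gradient at `θ` over the sub-batch of those data points whose label is `true`:
the average of `∇ℓ(θ; s)` over the sub-batch. -/
noncomputable def batchGrad {d n : ℕ} {X : Type*} (ℓ : ParamSpace d → X → ℝ)
    (θ : ParamSpace d) (data : Fin n → X) (label : Fin n → Bool) : ParamSpace d :=
  ((Finset.univ.filter fun u => label u = true).card : ℝ)⁻¹ •
    ∑ u ∈ Finset.univ.filter (fun u => label u = true), lossGrad ℓ θ (data u)

/-! ### The network -/

open Classical in
/-- The neighbour set `N_i` of the node `i`; it contains `i` itself (mixing matrices have self-loops). -/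
noncomputable def nbhd {m : ℕ} (Γ : SimpleGraph (Fin m)) (i : Fin m) : Finset (Fin m) :=
  Finset.univ.filter fun j => j = i ∨ Γ.Adj i j

/-- The normal neighbours `G_i = G ∩ N_i`, where `G` is the set of normal nodes. -/
noncomputable def normalNbhd {m : ℕ} (Γ : SimpleGraph (Fin m)) (G : Finset (Fin m)) (i : Fin m) :
    Finset (Fin m) :=
  (nbhd Γ i).filter fun j => j ∈ G

/-- The Byzantine neighbours `B_i = B ∩ N_i`, where `B` is the complement of `G`. -/
noncomputable def byzNbhd {m : ℕ} (Γ : SimpleGraph (Fin m)) (G : Finset (Fin m)) (i : Fin m) :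
    Finset (Fin m) :=
  (nbhd Γ i).filter fun j => j ∉ G

/-! ### Warm-up phase and sample splitting -/

/-- The average of the parameters of the normal nodes. -/
noncomputable def normalAverage {d m : ℕ} (G : Finset (Fin m)) (θ : Fin m → ParamSpace d) :
    ParamSpace d :=
  (G.card : ℝ)⁻¹ • ∑ j ∈ G, θ j

/-- The warm-up condition: the outputs `θ_j` of `k₀` warm-up iterations satisfy
`∑_{j ∈ G} ‖θ_j - θ̄‖² ≤ Cw / k₀^{1-δ}` with probability at least `1 - τw`. -/
def WarmUpCondition {d m : ℕ} {Ω : Type*} [MeasurableSpace Ω] (μ : Measure Ω)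
    (G : Finset (Fin m)) (θ : Fin m → Ω → ParamSpace d) (k₀ : ℕ) (Cw δ τw : ℝ) : Prop :=
  μ {ω | ¬ ∑ j ∈ G, ‖θ j ω - normalAverage G (fun i => θ i ω)‖ ^ 2 ≤ Cw / (k₀ : ℝ) ^ (1 - δ)}
    ≤ ENNReal.ofReal τw

/-- The random ingredients of the detection phase at the normal nodes. Node `j` holds an
identification set `data j 0, …, data j (n - 1)`, of which the points labelled `true` by `label j`
form the first sub-batch, of size `n / 2`. Over all normal nodes the identification data are i.i.d.
with law `P`, and they are independent of the warm-up output together with the splitting. -/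
structure SplitSampling {d m n : ℕ} {Ω X : Type*} [MeasurableSpace Ω] [MeasurableSpace X]
    (μ : Measure Ω) (P : Measure X) (G : Finset (Fin m)) (θ : Fin m → Ω → ParamSpace d)
    (data : Fin m → Fin n → Ω → X) (label : Fin m → Ω → Fin n → Bool) : Prop where
  measurable_param : ∀ j ∈ G, Measurable (θ j)
  measurable_data : ∀ j ∈ G, ∀ u, Measurable (data j u)
  measurable_label : ∀ j ∈ G, Measurable (label j)
  card_label : ∀ j ∈ G, ∀ ω, (Finset.univ.filter fun u => label j ω u = true).card = n / 2
  law : ∀ j ∈ G, ∀ u, μ.map (data j u) = P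
  iIndep : iIndepFun (fun p : G × Fin n => data p.1 p.2) μ
  indep : IndepFun (fun ω (p : G × Fin n) => data p.1 p.2 ω)
    (fun ω => ((fun j : G => θ j ω), (fun j : G => label j ω))) μ

/-! ### Robust mean estimators -/

/-- `g` is a coordinate-wise median of the vectors `(x j)_{j ∈ S}`: in every coordinate at least half
of the entries are `≤` that of `g` and at least half are `≥`. If `S` has even size, this allows every
convention for the choice between the two middle entries. -/
def IsCoordMedian {d m : ℕ} (S : Finset (Fin m)) (x : Fin m → ParamSpace d)
    (g : ParamSpace d) : Prop :=
  ∀ a : Fin d, S.card ≤ 2 * (S.filter fun j => x j a ≤ g a).card ∧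
    S.card ≤ 2 * (S.filter fun j => g a ≤ x j a).card

/-- The weighted mean `∑_{j ∈ S} w_j x_j`. -/
noncomputable def weightedMean {d m : ℕ} (S : Finset (Fin m)) (x : Fin m → ParamSpace d)
    (w : Fin m → ℝ) : ParamSpace d :=
  ∑ j ∈ S, w j • x j

/-- The weighted covariance `∑_{j ∈ S} w_j (x_j - μ_w)(x_j - μ_w)ᵀ` as an operator on `ℝ^d`; its norm
is the operator norm. -/
noncomputable def weightedCov {d m : ℕ} (S : Finset (Fin m)) (x : Fin m → ParamSpace d)
    (w : Fin m → ℝ) : ParamSpace d →L[ℝ] ParamSpace d :=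
  ∑ j ∈ S, w j • (innerSL ℝ (x j - weightedMean S x w)).smulRight (x j - weightedMean S x w)

/-- Admissible weights at contamination level `ε`: a probability vector on `S` none of whose entries
exceeds `1 / ((1 - ε) |S|)`. -/
def FilterWeights {m : ℕ} (S : Finset (Fin m)) (ε : ℝ) (w : Fin m → ℝ) : Prop :=
  (∀ j ∈ S, 0 ≤ w j ∧ w j ≤ ((1 - ε) * (S.card : ℝ))⁻¹) ∧ ∑ j ∈ S, w j = 1

/-- `g` is a Filtering estimate of `(x j)_{j ∈ S}` at contamination level `ε`: the weighted mean for
admissible weights that minimise the operator norm of the weighted covariance. -/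
def IsFilteringEstimate {d m : ℕ} (ε : ℝ) (S : Finset (Fin m)) (x : Fin m → ParamSpace d)
    (g : ParamSpace d) : Prop :=
  ∃ w : Fin m → ℝ, FilterWeights S ε w ∧
    (∀ w', FilterWeights S ε w' → ‖weightedCov S x w‖ ≤ ‖weightedCov S x w'‖) ∧
    g = weightedMean S x w

/-- The two robust mean estimators. -/
inductive RobustEstimator where
  | coordMedian
  | filtering

/-- `g` is an output of the robust mean estimator on the inputs `(x j)_{j ∈ S}`; the contamination
level `ε` is used by Filtering only. -/
def RobustEstimator.IsOutput {d m : ℕ} (est : RobustEstimator) (ε : ℝ) (S : Finset (Fin m))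
    (x : Fin m → ParamSpace d) (g : ParamSpace d) : Prop :=
  match est with
  | .coordMedian => IsCoordMedian S x g
  | .filtering => IsFilteringEstimate ε S x g

/-! The proof separates a deterministic robustness bound from a count of bad messages.

Deterministic part (`RobustEstimator.IsOutput.norm_sub_le`): if at least `(1 - ε)|S|` inputs lie
within `R` of a point `v`, either estimator lies within a constant times `R` of `v`. In the
neighbourhood of `j` the Byzantine nodes use up a fraction `ε₀`, so up to `(ε - ε₀)|N_j|` normal
messages may be off by more than `t`. The others are within `t` of their own population gradients,
which are close to that of `j` because the warm-up outputs nearly agree.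

Probabilistic part: given warm-up outputs and splits, the messages of the normal nodes are
independent, and by Chebyshev each is off with probability at most `q`, of order `1 / (n t²)`. With
`N = |N_j|`, having more than `(ε - ε₀) N` bad ones costs at most `N q` (some node is bad) and at
most `2 ^ N * q ^ ((ε - ε₀) N)` (some large set is bad); the latter is below `exp (-c N)` once `q`
is small. This gives `SplitSampling.measure_card_batchGrad_gt_le`; a union bound over `j` follows.

It remains to let `t` tend to `0` slowly. With `t² = s = √|ρ| + 1/√n`, `q = A / (n s)` tends to `0`,
and the summed failure probability is at most `(A / s) |ρ| ≤ A √|ρ|`. -/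

/-! ### Deterministic accuracy of the two estimators -/

theorem IsCoordMedian.abs_sub_le {d m : ℕ} {S H : Finset (Fin m)} {x : Fin m → ParamSpace d}
    {g v : ParamSpace d} {R : ℝ} (hg : IsCoordMedian S x g) (hHS : H ⊆ S)
    (hH : S.card < 2 * H.card) (hx : ∀ j ∈ H, ‖x j - v‖ ≤ R) (a : Fin d) :
    |g a - v a| ≤ R := by
  have key : ∀ p : Fin m → Prop, ∀ _ : DecidablePred p, S.card ≤ 2 * (S.filter p).card →
      ∃ j ∈ H, p j := by
    intro p _ hp
    -- Pigeonhole: half of `S` must meet the strict majority `H`. Applied to both sides of the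
    -- median, this traps `g a` between coordinates of good points.
    obtain ⟨j, hj⟩ := Finset.inter_nonempty_of_card_lt_card_add_card
      (Finset.filter_subset p S) hHS (by omega)
    rw [Finset.mem_inter, Finset.mem_filter] at hj
    exact ⟨j, hj.2, hj.1.2⟩
  have coord : ∀ j ∈ H, |x j a - v a| ≤ R := fun j hj =>
    (PiLp.norm_apply_le (x j - v) a).trans (hx j hj)
  obtain ⟨j, hj, hja⟩ := key _ _ (hg a).1
  obtain ⟨k, hk, hka⟩ := key _ _ (hg a).2
  have h1 := abs_le.1 (coord j hj)
  have h2 := abs_le.1 (coord k hk)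
  exact abs_le.2 ⟨by linarith, by linarith⟩

theorem IsCoordMedian.norm_sub_le {d m : ℕ} {S H : Finset (Fin m)} {x : Fin m → ParamSpace d}
    {g v : ParamSpace d} {R : ℝ} (hR : 0 ≤ R) (hg : IsCoordMedian S x g) (hHS : H ⊆ S)
    (hH : S.card < 2 * H.card) (hx : ∀ j ∈ H, ‖x j - v‖ ≤ R) :
    ‖g - v‖ ≤ √d * R := by
  rw [EuclideanSpace.norm_eq, ← Real.sqrt_sq hR, ← Real.sqrt_mul (Nat.cast_nonneg d)]
  refine Real.sqrt_le_sqrt ?_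
  calc ∑ a, ‖(g - v) a‖ ^ 2 ≤ ∑ _a : Fin d, R ^ 2 := by
        refine Finset.sum_le_sum fun a _ => ?_
        gcongr
        exact hg.abs_sub_le hHS hH hx a
    _ = d * R ^ 2 := by simp

theorem weightedMean_sub {d m : ℕ} {S : Finset (Fin m)} (x : Fin m → ParamSpace d)
    {w : Fin m → ℝ} (hw : ∑ j ∈ S, w j = 1) (v : ParamSpace d) :
    weightedMean S x w - v = ∑ j ∈ S, w j • (x j - v) := by
  simp only [smul_sub, Finset.sum_sub_distrib, ← Finset.sum_smul, hw, one_smul, weightedMean]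

theorem norm_weightedCov_le {d m : ℕ} {S : Finset (Fin m)} (x : Fin m → ParamSpace d)
    {w : Fin m → ℝ} (hw : ∀ j ∈ S, 0 ≤ w j) :
    ‖weightedCov S x w‖ ≤ ∑ j ∈ S, w j * ‖x j - weightedMean S x w‖ ^ 2 := by
  refine (norm_sum_le _ _).trans (Finset.sum_le_sum fun j hj => ?_)
  rw [norm_smul, Real.norm_of_nonneg (hw j hj), ContinuousLinearMap.norm_smulRight_apply,
    innerSL_apply_norm, sq]

theorem inner_weightedCov {d m : ℕ} (S : Finset (Fin m)) (x : Fin m → ParamSpace d)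
    (w : Fin m → ℝ) (u : ParamSpace d) :
    inner ℝ (weightedCov S x w u) u
      = ∑ j ∈ S, w j * inner ℝ (x j - weightedMean S x w) u ^ 2 := by
  simp only [weightedCov, sum_apply, sum_inner]
  refine Finset.sum_congr rfl fun j _ => ?_
  simp [inner_smul_left, inner_sub_left, sq]

/-- Uniform weights on a subset of size at least `(1 - ε) |S|` have small covariance if the points
of the subset are close to each other. -/
theorem exists_filterWeights_norm_weightedCov_le {d m : ℕ} {S H : Finset (Fin m)}
    {x : Fin m → ParamSpace d} {v : ParamSpace d} {ε R : ℝ} (hHS : H ⊆ S)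
    (hpos : 0 < (1 - ε) * (S.card : ℝ)) (hH : (1 - ε) * (S.card : ℝ) ≤ H.card)
    (hx : ∀ j ∈ H, ‖x j - v‖ ≤ R) :
    ∃ w, FilterWeights S ε w ∧ ‖weightedCov S x w‖ ≤ 4 * R ^ 2 := by
  have hHpos : (0 : ℝ) < H.card := hpos.trans_le hH
  set w : Fin m → ℝ := fun j => if j ∈ H then (H.card : ℝ)⁻¹ else 0 with hwdef
  have hsum : ∀ f : Fin m → ℝ, ∑ j ∈ S, w j * f j = ∑ j ∈ H, (H.card : ℝ)⁻¹ * f j := by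
    intro f
    simp only [hwdef, ite_mul, zero_mul]
    rw [← Finset.sum_filter, Finset.filter_mem_eq_inter, Finset.inter_eq_right.2 hHS]
  have hw0 : ∀ j ∈ S, 0 ≤ w j := fun j _ => by
    simp only [hwdef]; split_ifs <;> positivity
  have hw1 : ∑ j ∈ S, w j = 1 := by
    have := hsum fun _ => 1
    simp only [mul_one] at this
    rw [this, Finset.sum_const, nsmul_eq_mul, mul_inv_cancel₀ hHpos.ne']
  have hle : ∀ (f : Fin m → ℝ) (A : ℝ), (∀ j ∈ H, f j ≤ A) → ∑ j ∈ S, w j * f j ≤ A := by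
    intro f A hf
    rw [hsum]
    calc ∑ j ∈ H, (H.card : ℝ)⁻¹ * f j ≤ ∑ _j ∈ H, (H.card : ℝ)⁻¹ * A := by
          refine Finset.sum_le_sum fun j hj => ?_
          gcongr
          exact hf j hj
      _ = A := by
          rw [Finset.sum_const, nsmul_eq_mul, mul_inv_cancel_left₀ hHpos.ne']
  refine ⟨w, ⟨fun j hj => ⟨hw0 j hj, ?_⟩, hw1⟩, ?_⟩
  · simp only [hwdef]
    split_ifs
    · gcongr
    · positivity
  · have hmean : ‖weightedMean S x w - v‖ ≤ R := by
      rw [weightedMean_sub x hw1]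
      refine (norm_sum_le _ _).trans ?_
      rw [Finset.sum_congr rfl fun j hj => by rw [norm_smul, Real.norm_of_nonneg (hw0 j hj)]]
      exact hle _ _ hx
    refine (norm_weightedCov_le x hw0).trans (hle _ _ fun j hj => ?_)
    have : ‖x j - weightedMean S x w‖ ≤ 2 * R := by
      calc ‖x j - weightedMean S x w‖ ≤ ‖x j - v‖ + ‖weightedMean S x w - v‖ := by
            rw [norm_sub_rev (weightedMean S x w)]; exact norm_sub_le_norm_sub_add_norm_sub _ _ _
        _ ≤ 2 * R := by linarith [hx j hj]
    calc ‖x j - weightedMean S x w‖ ^ 2 ≤ (2 * R) ^ 2 := by gcongr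
      _ = 4 * R ^ 2 := by ring

/-- At most `ε|S|` points lie outside `H`, and the cap on the weights limits their mass to `ε / (1 -
ε)`. -/
theorem FilterWeights.le_sum {m : ℕ} {S H : Finset (Fin m)} {ε : ℝ} {w : Fin m → ℝ}
    (hw : FilterWeights S ε w) (hHS : H ⊆ S) (hpos : 0 < (1 - ε) * (S.card : ℝ))
    (hH : (1 - ε) * (S.card : ℝ) ≤ H.card) (hS : 0 < (S.card : ℝ)) :
    (1 - 2 * ε) / (1 - ε) ≤ ∑ j ∈ H, w j := by
  have hε : 0 < 1 - ε := pos_of_mul_pos_left hpos hS.le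
  have h1 := Finset.sum_sdiff (f := w) hHS
  rw [hw.2] at h1
  have h2 : ∑ j ∈ S \ H, w j ≤ ((S \ H).card : ℝ) * ((1 - ε) * (S.card : ℝ))⁻¹ := by
    rw [← nsmul_eq_mul]
    exact Finset.sum_le_card_nsmul _ _ _ fun j hj => (hw.1 j (Finset.mem_sdiff.1 hj).1).2
  have h3 : ((S \ H).card : ℝ) ≤ ε * S.card := by
    rw [Finset.cast_card_sdiff hHS]; linarith
  have h4 : ((S \ H).card : ℝ) * ((1 - ε) * (S.card : ℝ))⁻¹ ≤ ε / (1 - ε) := by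
    calc ((S \ H).card : ℝ) * ((1 - ε) * (S.card : ℝ))⁻¹
        ≤ ε * S.card * ((1 - ε) * (S.card : ℝ))⁻¹ := by gcongr
      _ = ε / (1 - ε) := by field_simp
  have h5 : (1 - 2 * ε) / (1 - ε) = 1 - ε / (1 - ε) := by field_simp; ring
  linarith

/-- Optimality against uniform weights on `H` bounds the covariance by `4 R²`. If the weighted mean
were far from `v`, the good points, which keep mass at least `κ`, would all lie far from that mean
in the direction `u` and create a larger variance along `u`. -/
theorem IsFilteringEstimate.norm_sub_le {d m : ℕ} {S H : Finset (Fin m)}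
    {x : Fin m → ParamSpace d} {g v : ParamSpace d} {ε R : ℝ} (hR : 0 ≤ R) (hε : ε < 1 / 2)
    (hg : IsFilteringEstimate ε S x g) (hHS : H ⊆ S) (hS : S.Nonempty)
    (hH : (1 - ε) * (S.card : ℝ) ≤ H.card) (hx : ∀ j ∈ H, ‖x j - v‖ ≤ R) :
    ‖g - v‖ ≤ (1 + 2 / √((1 - 2 * ε) / (1 - ε))) * R := by
  have hS' : (0 : ℝ) < S.card := by exact_mod_cast hS.card_pos
  have hpos : 0 < (1 - ε) * (S.card : ℝ) := mul_pos (by linarith) hS'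
  obtain ⟨w, hw, hmin, rfl⟩ := hg
  obtain ⟨w', hw', hcov'⟩ := exists_filterWeights_norm_weightedCov_le hHS hpos hH hx
  have hcov := (hmin w' hw').trans hcov'
  set κ := (1 - 2 * ε) / (1 - ε)
  have hκ : 0 < κ := div_pos (by linarith) (by linarith)
  have hκle : κ ≤ ∑ j ∈ H, w j := hw.le_sum hHS hpos hH hS'
  set M := weightedMean S x w
  set u := v - M with hu
  rw [norm_sub_rev]
  -- The lower bound `‖u‖ (‖u‖ - R)` for the inner products can be squared only when it is
  -- nonnegative.
  by_cases hcase : ‖u‖ ≤ R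
  · refine hcase.trans (le_mul_of_one_le_left hR ?_)
    have : 0 ≤ 2 / √κ := by positivity
    linarith
  push Not at hcase
  have hupos : 0 < ‖u‖ := hR.trans_lt hcase
  have hlow : κ * (‖u‖ * (‖u‖ - R)) ^ 2 ≤ 4 * R ^ 2 * ‖u‖ ^ 2 := by
    calc κ * (‖u‖ * (‖u‖ - R)) ^ 2 ≤ (∑ j ∈ H, w j) * (‖u‖ * (‖u‖ - R)) ^ 2 := by gcongr
      _ ≤ ∑ j ∈ H, w j * inner ℝ (x j - M) u ^ 2 := by
        rw [Finset.sum_mul]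
        refine Finset.sum_le_sum fun j hj => ?_
        refine mul_le_mul_of_nonneg_left ?_ (hw.1 j (hHS hj)).1
        refine pow_le_pow_left₀ (mul_nonneg hupos.le (by linarith)) ?_ 2
        have h1 : x j - M = (x j - v) + u := by rw [hu]; abel
        have h2 := abs_le.1 (abs_real_inner_le_norm (x j - v) u)
        have h3 : ‖x j - v‖ * ‖u‖ ≤ R * ‖u‖ := by gcongr; exact hx j hj
        rw [h1, inner_add_left, real_inner_self_eq_norm_sq]
        nlinarith [h2.1]
      _ ≤ ∑ j ∈ S, w j * inner ℝ (x j - M) u ^ 2 :=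
        Finset.sum_le_sum_of_subset_of_nonneg hHS fun j hj _ =>
          mul_nonneg (hw.1 j hj).1 (sq_nonneg _)
      _ = inner ℝ (weightedCov S x w u) u := (inner_weightedCov S x w u).symm
      _ ≤ ‖weightedCov S x w u‖ * ‖u‖ := real_inner_le_norm _ _
      _ ≤ ‖weightedCov S x w‖ * ‖u‖ * ‖u‖ := by
        gcongr; exact ContinuousLinearMap.le_opNorm _ _
      _ ≤ 4 * R ^ 2 * ‖u‖ * ‖u‖ := by gcongr
      _ = 4 * R ^ 2 * ‖u‖ ^ 2 := by ring
  have hlow' : (√κ * (‖u‖ - R)) ^ 2 ≤ (2 * R) ^ 2 := by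
    rw [mul_pow, Real.sq_sqrt hκ.le]
    refine le_of_mul_le_mul_right (a := ‖u‖ ^ 2) ?_ (by positivity)
    calc κ * (‖u‖ - R) ^ 2 * ‖u‖ ^ 2 = κ * (‖u‖ * (‖u‖ - R)) ^ 2 := by ring
      _ ≤ 4 * R ^ 2 * ‖u‖ ^ 2 := hlow
      _ = (2 * R) ^ 2 * ‖u‖ ^ 2 := by ring
  have h6 : √κ * (‖u‖ - R) ≤ 2 * R := (le_abs_self _).trans (abs_le_of_sq_le_sq hlow' (by linarith))
  have h7 : ‖u‖ - R ≤ 2 * R / √κ := by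
    rw [le_div_iff₀ (Real.sqrt_pos.2 hκ)]; linarith
  calc ‖u‖ ≤ R + 2 * R / √κ := by linarith
    _ = (1 + 2 / √κ) * R := by ring

/-- The factor by which the robust mean estimators amplify the deviation of the good inputs. -/
noncomputable def robustFactor (d : ℕ) (ε : ℝ) : ℝ :=
  √d + (1 + 2 / √((1 - 2 * ε) / (1 - ε)))

theorem robustFactor_pos (d : ℕ) (ε : ℝ) : 0 < robustFactor d ε := by
  unfold robustFactor; positivity

theorem RobustEstimator.IsOutput.norm_sub_le {est : RobustEstimator} {d m : ℕ}
    {S H : Finset (Fin m)} {x : Fin m → ParamSpace d} {g v : ParamSpace d} {ε R : ℝ} (hR : 0 ≤ R)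
    (hε : ε < 1 / 2) (hg : est.IsOutput ε S x g) (hHS : H ⊆ S) (hS : S.Nonempty)
    (hH : (1 - ε) * (S.card : ℝ) ≤ H.card) (hx : ∀ j ∈ H, ‖x j - v‖ ≤ R) :
    ‖g - v‖ ≤ robustFactor d ε * R := by
  have hS' : (0 : ℝ) < S.card := by exact_mod_cast hS.card_pos
  cases est with
  | coordMedian =>
    have hcard : S.card < 2 * H.card := by
      have : (S.card : ℝ) < 2 * H.card := by nlinarith
      exact_mod_cast this
    refine (IsCoordMedian.norm_sub_le hR hg hHS hcard hx).trans ?_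
    exact mul_le_mul_of_nonneg_right (le_add_of_nonneg_right (by positivity)) hR
  | filtering =>
    refine (IsFilteringEstimate.norm_sub_le hR hε hg hHS hS hH hx).trans ?_
    exact mul_le_mul_of_nonneg_right (le_add_of_nonneg_left (by positivity)) hR

/-! ### Measurability and the mean of the sample gradient -/

namespace RegularLoss

variable {d : ℕ} {X : Type*} [MeasurableSpace X] {ℓ : ParamSpace d → X → ℝ} {P : Measure X}
  {L σ₀ : ℝ}

theorem lossGrad_apply (h : RegularLoss ℓ P L σ₀) (θ : ParamSpace d) (s : X) (a : Fin d) :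
    lossGrad ℓ θ s a = fderiv ℝ (fun x => ℓ x s) θ (EuclideanSpace.single a 1) := by
  have hd : DifferentiableAt ℝ (fun x => ℓ x s) θ :=
    (h.contDiff s).differentiable one_ne_zero θ
  rw [hd.hasGradientAt.hasFDerivAt.fderiv, InnerProductSpace.toDual_apply_apply,
    EuclideanSpace.inner_single_right]
  simp [lossGrad]

/-- Each coordinate is a pointwise limit of difference quotients with step `1/k`, which are
measurable in the sample. -/
theorem measurable_lossGrad (h : RegularLoss ℓ P L σ₀) (θ : ParamSpace d) :
    Measurable (lossGrad ℓ θ) := by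
  have hcoord : ∀ a, Measurable fun s => lossGrad ℓ θ s a := by
    intro a
    refine measurable_of_tendsto_metrizable (f := fun (k : ℕ) s =>
      (k : ℝ) • (ℓ (θ + (k : ℝ)⁻¹ • EuclideanSpace.single a 1) s - ℓ θ s))
      (fun k => ((h.measurable _).sub (h.measurable _)).const_mul (k : ℝ)) ?_
    rw [tendsto_pi_nhds]
    intro s
    have hd : DifferentiableAt ℝ (fun x => ℓ x s) θ :=
      (h.contDiff s).differentiable one_ne_zero θ
    rw [h.lossGrad_apply]
    exact (hd.hasFDerivAt.lim_real _).comp tendsto_natCast_atTop_atTop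
  exact (MeasurableEquiv.toLp 2 (Fin d → ℝ)).measurable.comp (measurable_pi_lambda _ hcoord)

theorem continuous_lossGrad (h : RegularLoss ℓ P L σ₀) (s : X) :
    Continuous fun θ => lossGrad ℓ θ s :=
  (InnerProductSpace.toDual ℝ (ParamSpace d)).symm.continuous.comp
    ((h.contDiff s).continuous_fderiv one_ne_zero)

/-- Carathéodory argument. Joint measurability is needed because the gradient is evaluated at a
random parameter. -/
theorem measurable_uncurry_lossGrad (h : RegularLoss ℓ P L σ₀) :
    Measurable (Function.uncurry (lossGrad ℓ)) :=
  measurable_uncurry_of_continuous_of_measurable h.continuous_lossGrad h.measurable_lossGrad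

theorem norm_meanGrad_sub_le [IsProbabilityMeasure P] (h : RegularLoss ℓ P L σ₀)
    (x y : ParamSpace d) : ‖meanGrad ℓ P x - meanGrad ℓ P y‖ ≤ |L| * ‖x - y‖ := by
  unfold meanGrad
  rw [← integral_sub ((h.memLp x).integrable one_le_two) ((h.memLp y).integrable one_le_two)]
  refine (norm_integral_le_of_norm_le_const (h.lipschitz.mono fun s hs => hs x y)).trans ?_
  rw [probReal_univ, mul_one]
  gcongr
  exact le_abs_self L

theorem measurable_meanGrad [IsProbabilityMeasure P] (h : RegularLoss ℓ P L σ₀) :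
    Measurable (meanGrad ℓ P) := by
  have : LipschitzWith (Real.nnabs L) (meanGrad ℓ P) := LipschitzWith.of_dist_le_mul fun x y => by
    rw [dist_eq_norm, dist_eq_norm]; exact h.norm_meanGrad_sub_le x y
  exact this.continuous.measurable

end RegularLoss

/-! ### Deviation of the batch gradient -/

/-- The mean squared deviation of a weighted average of i.i.d. vectors. -/
theorem integral_norm_weighted_sum_sub_sq {d n : ℕ} {X : Type*} [MeasurableSpace X]
    {P : Measure X} [IsProbabilityMeasure P] {f : X → ParamSpace d} (hf : MemLp f 2 P)
    {c : Fin n → ℝ} (hc : ∑ u, c u = 1) :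
    Integrable (fun x : Fin n → X => ‖∑ u, c u • f (x u) - ∫ s, f s ∂P‖ ^ 2)
        (Measure.pi fun _ => P) ∧
      ∫ x : Fin n → X, ‖∑ u, c u • f (x u) - ∫ s, f s ∂P‖ ^ 2 ∂(Measure.pi fun _ => P)
        = (∑ u, c u ^ 2) * ∫ s, ‖f s - ∫ s', f s' ∂P‖ ^ 2 ∂P := by
  set M := ∫ s, f s ∂P with hM
  have hfa : ∀ a, MemLp (fun s => f s a) 2 P := memLp_piLp_iff.1 hf
  have hMa : ∀ a, M a = ∫ s, f s a ∂P :=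
    fun a => eval_integral_piLp (fun a => (hfa a).integrable one_le_two) a
  have hY : ∀ a u, MemLp (fun s => c u * f s a) 2 P := fun a u => (hfa a).const_mul (c u)
  -- The squared norm splits over coordinates, so that additivity of the scalar variance under a
  -- product measure applies.
  set Y : Fin d → (Fin n → X) → ℝ := fun a => ∑ u, fun x => c u * f (x u) a with hYdef
  have hYa : ∀ a, MemLp (Y a) 2 (Measure.pi fun _ : Fin n => P) := fun a =>
    memLp_finsetSum' _ fun u _ =>
      (hY a u).comp_measurePreserving (measurePreserving_eval (fun _ : Fin n => P) u)
  have hYmean : ∀ a, ∫ x, Y a x ∂(Measure.pi fun _ : Fin n => P) = M a := by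
    intro a
    simp only [hYdef, Finset.sum_apply]
    rw [integral_finsetSum (f := fun u (x : Fin n → X) => c u * f (x u) a) _ fun u _ =>
      ((hY a u).comp_measurePreserving
        (measurePreserving_eval (fun _ : Fin n => P) u)).integrable one_le_two]
    rw [Finset.sum_congr rfl fun u _ => integral_comp_eval (μ := fun _ : Fin n => P) (i := u)
      (hY a u).aestronglyMeasurable]
    simp only [integral_const_mul]
    rw [← Finset.sum_mul, hc, one_mul, hMa]
  have hexp : ∀ x : Fin n → X, ‖∑ u, c u • f (x u) - M‖ ^ 2 = ∑ a, (Y a x - M a) ^ 2 := by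
    intro x
    rw [EuclideanSpace.real_norm_sq_eq]
    refine Finset.sum_congr rfl fun a _ => ?_
    simp [hYdef]
  have hint : ∀ a, Integrable (fun x => (Y a x - M a) ^ 2) (Measure.pi fun _ : Fin n => P) :=
    fun a => ((hYa a).sub (memLp_const (M a))).integrable_sq
  simp only [hexp]
  refine ⟨integrable_finsetSum _ fun a _ => hint a, ?_⟩
  rw [integral_finsetSum _ fun a _ => hint a]
  have hexp' : ∀ s, ‖f s - M‖ ^ 2 = ∑ a, (f s a - M a) ^ 2 := by
    intro s
    rw [EuclideanSpace.real_norm_sq_eq]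
    simp
  simp only [hexp']
  rw [integral_finsetSum (f := fun a s => (f s a - M a) ^ 2) _ fun a _ =>
    ((hfa a).sub (memLp_const (M a))).integrable_sq, Finset.mul_sum]
  refine Finset.sum_congr rfl fun a _ => ?_
  have h1 := variance_eq_integral (hYa a).aestronglyMeasurable.aemeasurable
  have h2 := variance_eq_integral (hfa a).aestronglyMeasurable.aemeasurable
  rw [hYmean] at h1
  rw [← hMa] at h2
  rw [← h1, ← h2, hYdef, variance_sum_pi (hY a)]
  simp only [variance_const_mul]
  rw [Finset.sum_mul]

theorem batchGrad_eq_sum {d n : ℕ} {X : Type*} (ℓ : ParamSpace d → X → ℝ) (θ : ParamSpace d)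
    (x : Fin n → X) (b : Fin n → Bool) :
    batchGrad ℓ θ x b = ∑ u, (if b u = true then
      ((Finset.univ.filter fun u => b u = true).card : ℝ)⁻¹ else 0) • lossGrad ℓ θ (x u) := by
  simp only [batchGrad, Finset.smul_sum, ite_smul, zero_smul]
  rw [Finset.sum_filter]

/-- Chebyshev for fixed parameter and split: weights `1/k` on `k` samples have square sum `1/k`. -/
theorem RegularLoss.measure_pi_batchGrad_gt_le {d n : ℕ} {X : Type*} [MeasurableSpace X]
    {ℓ : ParamSpace d → X → ℝ} {P : Measure X} [IsProbabilityMeasure P] {L σ₀ : ℝ}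
    (h : RegularLoss ℓ P L σ₀) (θ : ParamSpace d) {b : Fin n → Bool} {k : ℕ} (hk : 0 < k)
    (hb : (Finset.univ.filter fun u => b u = true).card = k) {t : ℝ} (ht : 0 < t) :
    (Measure.pi fun _ : Fin n => P) {x | t < ‖batchGrad ℓ θ x b - meanGrad ℓ P θ‖}
      ≤ ENNReal.ofReal (σ₀ ^ 2 / (k * t ^ 2)) := by
  have hk' : (k : ℝ) ≠ 0 := by exact_mod_cast hk.ne'
  have hkp : (0 : ℝ) < k := by exact_mod_cast hk
  have hc : ∑ u, (if b u = true then (k : ℝ)⁻¹ else 0) = 1 := by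
    rw [← Finset.sum_filter, Finset.sum_const, hb, nsmul_eq_mul, mul_inv_cancel₀ hk']
  have hc2 : ∑ u, (if b u = true then (k : ℝ)⁻¹ else 0) ^ 2 = (k : ℝ)⁻¹ := by
    simp only [ite_pow, ne_eq, OfNat.ofNat_ne_zero, not_false_eq_true, zero_pow]
    rw [← Finset.sum_filter, Finset.sum_const, hb, nsmul_eq_mul, sq, mul_inv_cancel_left₀ hk']
  obtain ⟨hint, heq⟩ := integral_norm_weighted_sum_sub_sq (h.memLp θ) hc
  have hmarkov := mul_meas_ge_le_integral_of_nonneg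
    (Eventually.of_forall fun x => sq_nonneg _) hint (t ^ 2)
  rw [heq, hc2] at hmarkov
  have hsub : {x | t < ‖batchGrad ℓ θ x b - meanGrad ℓ P θ‖} ⊆
      {x : Fin n → X | t ^ 2 ≤ ‖∑ u, (if b u = true then (k : ℝ)⁻¹ else 0) • lossGrad ℓ θ (x u)
        - ∫ s, lossGrad ℓ θ s ∂P‖ ^ 2} := by
    intro x hx
    rw [Set.mem_ofPred_eq, batchGrad_eq_sum, hb] at hx
    exact pow_le_pow_left₀ ht.le hx.le 2
  refine (measure_mono hsub).trans ?_
  rw [← ofReal_measureReal]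
  refine ENNReal.ofReal_le_ofReal ?_
  rw [le_div_iff₀ (by positivity)]
  have hv := h.variance_le θ
  calc _ = k * (t ^ 2 * (Measure.pi fun _ : Fin n => P).real
        {x : Fin n → X | t ^ 2 ≤ ‖∑ u, (if b u = true then (k : ℝ)⁻¹ else 0) • lossGrad ℓ θ (x u)
        - ∫ s, lossGrad ℓ θ s ∂P‖ ^ 2}) := by ring
    _ ≤ k * ((k : ℝ)⁻¹ * ∫ s, ‖lossGrad ℓ θ s - ∫ s', lossGrad ℓ θ s' ∂P‖ ^ 2 ∂P) := by
      gcongr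
    _ = ∫ s, ‖lossGrad ℓ θ s - ∫ s', lossGrad ℓ θ s' ∂P‖ ^ 2 ∂P := by field_simp
    _ ≤ σ₀ ^ 2 := hv

/-! ### Joint deviation at several nodes -/

/-- This product form allows Fubini with the warm-up outputs and splits frozen. -/
theorem SplitSampling.map_eq_prod {d m n : ℕ} {Ω X : Type*} [MeasurableSpace Ω]
    [MeasurableSpace X] {μ : Measure Ω} [IsProbabilityMeasure μ] {P : Measure X}
    [IsProbabilityMeasure P] {G : Finset (Fin m)} {θ : Fin m → Ω → ParamSpace d}
    {data : Fin m → Fin n → Ω → X} {label : Fin m → Ω → Fin n → Bool}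
    (h : SplitSampling μ P G θ data label) :
    μ.map (fun ω => ((fun (j : G) u => data j u ω),
        ((fun j : G => θ j ω), (fun j : G => label j ω))))
      = (Measure.pi fun _ : G => Measure.pi fun _ : Fin n => P).prod
        (μ.map fun ω => ((fun j : G => θ j ω), (fun j : G => label j ω))) := by
  have hdata : Measurable fun ω (p : G × Fin n) => data p.1 p.2 ω :=
    measurable_pi_lambda _ fun p => h.measurable_data p.1 p.1.2 p.2
  have hrest : Measurable fun ω => ((fun j : G => θ j ω), (fun j : G => label j ω)) :=
    (measurable_pi_lambda _ fun j : G => h.measurable_param j j.2).prodMk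
      (measurable_pi_lambda _ fun j : G => h.measurable_label j j.2)
  have hcurry : Measurable (MeasurableEquiv.curry G (Fin n) X) :=
    (MeasurableEquiv.curry G (Fin n) X).measurable
  have hlaw : μ.map (fun ω (p : G × Fin n) => data p.1 p.2 ω)
      = Measure.pi fun _ : G × Fin n => P := by
    rw [(iIndepFun_iff_map_fun_eq_pi_map fun p : G × Fin n =>
      (h.measurable_data p.1 p.1.2 p.2).aemeasurable).1 h.iIndep]
    congr with p : 1
    exact h.law p.1 p.1.2 p.2
  have hcurried : μ.map (fun ω (j : G) u => data j u ω)
      = Measure.pi fun _ : G => Measure.pi fun _ : Fin n => P := by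
    have := Measure.infinitePi_map_curry (fun (_ : G) (_ : Fin n) => P)
    simp only [Measure.infinitePi_eq_pi] at this
    rw [← this, ← hlaw, Measure.map_map hcurry hdata]
    rfl
  have hind : IndepFun (fun ω (j : G) u => data j u ω)
      (fun ω => ((fun j : G => θ j ω), (fun j : G => label j ω))) μ :=
    h.indep.comp hcurry measurable_id
  have hdata' : Measurable fun ω (j : G) u => data j u ω := hcurry.comp hdata
  rw [hind.map_prod_eq_prod_map_map hdata'.aemeasurable hrest.aemeasurable, hcurried]

theorem RegularLoss.measurable_batchGrad {d n : ℕ} {X : Type*} [MeasurableSpace X]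
    {ℓ : ParamSpace d → X → ℝ} {P : Measure X} {L σ₀ : ℝ} (h : RegularLoss ℓ P L σ₀) :
    Measurable fun p : ParamSpace d × (Fin n → X) × (Fin n → Bool) =>
      batchGrad ℓ p.1 p.2.1 p.2.2 := by
  have hg : ∀ u, Measurable fun p : ParamSpace d × (Fin n → X) × (Fin n → Bool) =>
      lossGrad ℓ p.1 (p.2.1 u) := fun u =>
    h.measurable_uncurry_lossGrad.comp
      (measurable_fst.prodMk ((measurable_pi_apply u).comp (measurable_fst.comp measurable_snd)))
  have hw : ∀ u, Measurable fun b : Fin n → Bool => if b u = true then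
      ((Finset.univ.filter fun u => b u = true).card : ℝ)⁻¹ else 0 := fun u =>
    measurable_of_countable _
  simp only [batchGrad_eq_sum]
  exact Finset.measurable_fun_sum _ fun u _ =>
    ((hw u).comp (measurable_snd.comp measurable_snd)).smul (hg u)

theorem RegularLoss.measurableSet_batchGrad_gt {d n : ℕ} {X : Type*} [MeasurableSpace X]
    {ℓ : ParamSpace d → X → ℝ} {P : Measure X} [IsProbabilityMeasure P] {L σ₀ : ℝ}
    (h : RegularLoss ℓ P L σ₀) (k : ℕ) (t : ℝ) :
    MeasurableSet {p : ParamSpace d × (Fin n → X) × (Fin n → Bool) |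
      (Finset.univ.filter fun u => p.2.2 u = true).card = k ∧
      t < ‖batchGrad ℓ p.1 p.2.1 p.2.2 - meanGrad ℓ P p.1‖} := by
  have hcard : Measurable fun p : ParamSpace d × (Fin n → X) × (Fin n → Bool) =>
      (Finset.univ.filter fun u => p.2.2 u = true).card :=
    (measurable_of_countable fun b : Fin n → Bool =>
      (Finset.univ.filter fun u => b u = true).card).comp (measurable_snd.comp measurable_snd)
  exact (measurableSet_eq_fun hcard measurable_const).inter
    (measurableSet_lt measurable_const
      (h.measurable_batchGrad.sub (h.measurable_meanGrad.comp measurable_fst)).norm)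

/-- The probability that the first-half gradients of all nodes of `T` deviate from their means. -/
theorem SplitSampling.measure_forall_batchGrad_gt_le {d m n : ℕ} {Ω X : Type*}
    [MeasurableSpace Ω] [MeasurableSpace X] {μ : Measure Ω} [IsProbabilityMeasure μ]
    {P : Measure X} [IsProbabilityMeasure P] {G T : Finset (Fin m)}
    {θ : Fin m → Ω → ParamSpace d} {data : Fin m → Fin n → Ω → X}
    {label : Fin m → Ω → Fin n → Bool} {ℓ : ParamSpace d → X → ℝ} {L σ₀ : ℝ}
    (h : SplitSampling μ P G θ data label) (hℓ : RegularLoss ℓ P L σ₀) (hT : T ⊆ G)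
    (hn : 0 < n / 2) {t : ℝ} (ht : 0 < t) :
    μ {ω | ∀ j ∈ T, t < ‖batchGrad ℓ (θ j ω) (fun u => data j u ω) (label j ω)
        - meanGrad ℓ P (θ j ω)‖}
      ≤ ENNReal.ofReal (σ₀ ^ 2 / ((n / 2 : ℕ) * t ^ 2)) ^ T.card := by
  -- The cardinality condition is part of the event because the slices below run over all label
  -- values, including those of the wrong size; for these the slice is empty.
  let D : Set (ParamSpace d × (Fin n → X) × (Fin n → Bool)) :=
    {p | (Finset.univ.filter fun u => p.2.2 u = true).card = n / 2 ∧
      t < ‖batchGrad ℓ p.1 p.2.1 p.2.2 - meanGrad ℓ P p.1‖}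
  have hD : MeasurableSet D := hℓ.measurableSet_batchGrad_gt (n / 2) t
  let B : G → Set (ParamSpace d × (Fin n → X) × (Fin n → Bool)) := fun j =>
    if (j : Fin m) ∈ T then D else Set.univ
  have hBmem : ∀ j : G, (j : Fin m) ∈ T → B j = D := fun j hj => if_pos hj
  have hBnot : ∀ j : G, (j : Fin m) ∉ T → B j = Set.univ := fun j hj => if_neg hj
  have hB : ∀ j, MeasurableSet (B j) := by
    intro j
    by_cases hj : (j : Fin m) ∈ T
    · rw [hBmem j hj]; exact hD
    · rw [hBnot j hj]; exact MeasurableSet.univ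
  let A : Set ((G → Fin n → X) × ((G → ParamSpace d) × (G → Fin n → Bool))) :=
    ⋂ j : G, (fun p => (p.2.1 j, p.1 j, p.2.2 j)) ⁻¹' B j
  have hA : MeasurableSet A := MeasurableSet.iInter fun j =>
    (show Measurable fun p : (G → Fin n → X) × ((G → ParamSpace d) × (G → Fin n → Bool)) =>
      (p.2.1 j, p.1 j, p.2.2 j) by fun_prop) (hB j)
  have hdata : Measurable fun ω => ((fun (j : G) u => data j u ω),
      ((fun j : G => θ j ω), (fun j : G => label j ω))) :=
    (measurable_pi_lambda _ fun j : G => measurable_pi_lambda _ fun u =>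
      h.measurable_data j j.2 u).prodMk
    ((measurable_pi_lambda _ fun j : G => h.measurable_param j j.2).prodMk
      (measurable_pi_lambda _ fun j : G => h.measurable_label j j.2))
  have hrest : Measurable fun ω => ((fun j : G => θ j ω), (fun j : G => label j ω)) :=
    (measurable_pi_lambda _ fun j : G => h.measurable_param j j.2).prodMk
      (measurable_pi_lambda _ fun j : G => h.measurable_label j j.2)
  have hsub : {ω | ∀ j ∈ T, t < ‖batchGrad ℓ (θ j ω) (fun u => data j u ω) (label j ω)
        - meanGrad ℓ P (θ j ω)‖} ⊆
      (fun ω => ((fun (j : G) u => data j u ω),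
      ((fun j : G => θ j ω), (fun j : G => label j ω)))) ⁻¹' A := by
    intro ω hω
    refine Set.mem_iInter.2 fun j => ?_
    by_cases hj : (j : Fin m) ∈ T
    · rw [hBmem j hj]
      exact ⟨h.card_label j j.2 ω, hω j hj⟩
    · rw [hBnot j hj]; trivial
  refine (measure_mono hsub).trans ?_
  rw [← Measure.map_apply hdata hA, h.map_eq_prod, Measure.prod_apply_symm hA]
  have := Measure.isProbabilityMeasure_map (μ := μ) hrest.aemeasurable
  set q := ENNReal.ofReal (σ₀ ^ 2 / ((n / 2 : ℕ) * t ^ 2))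
  calc _ ≤ ∫⁻ _, q ^ T.card ∂(μ.map fun ω => ((fun j : G => θ j ω), (fun j : G => label j ω))) := ?_
    _ = q ^ T.card := by simp
  refine lintegral_mono fun y => ?_
  -- With parameters and labels frozen the event is a box, so its probability factorizes over the
  -- nodes.
  have hslice : (fun x => (x, y)) ⁻¹' A
      = Set.univ.pi fun j => {x | (y.1 j, x, y.2 j) ∈ B j} := by
    ext x
    simp [A]
  rw [hslice, Measure.pi_pi]
  have hfac : ∀ j : G, (Measure.pi fun _ : Fin n => P) {x | (y.1 j, x, y.2 j) ∈ B j}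
      ≤ if (j : Fin m) ∈ T then q else 1 := by
    intro j
    by_cases hj : (j : Fin m) ∈ T
    · rw [hBmem j hj, if_pos hj]
      by_cases hcard : (Finset.univ.filter fun u => y.2 j u = true).card = n / 2
      · refine (measure_mono fun x hx => ?_).trans
          (hℓ.measure_pi_batchGrad_gt_le (y.1 j) hn hcard ht)
        exact hx.2
      · have : {x : Fin n → X | (y.1 j, x, y.2 j) ∈ D} = ∅ :=
          Set.eq_empty_of_forall_notMem fun x hx => hcard hx.1
        rw [this, measure_empty]
        exact zero_le
    · rw [if_neg hj]
      exact prob_le_one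
  calc _ ≤ ∏ j : G, if (j : Fin m) ∈ T then q else 1 := Finset.prod_le_prod' fun j _ => hfac j
    _ = ∏ j ∈ G, if j ∈ T then q else 1 := Finset.prod_coe_sort G fun j => if j ∈ T then q else 1
    _ = q ^ T.card := by
      rw [Finset.prod_ite_mem, Finset.inter_eq_right.2 hT, Finset.prod_const]

/-! ### The number of deviating nodes -/

open Classical in
-- Two union bounds, one for each argument of the minimum: over single bad nodes, and over the at
-- most `2 ^ N` subsets with more than `η N` elements, each entirely bad with probability at most `q
-- ^ (η N)`.
theorem SplitSampling.measure_card_batchGrad_gt_le {d m n : ℕ} {Ω X : Type*}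
    [MeasurableSpace Ω] [MeasurableSpace X] {μ : Measure Ω} [IsProbabilityMeasure μ]
    {P : Measure X} [IsProbabilityMeasure P] {G S : Finset (Fin m)}
    {θ : Fin m → Ω → ParamSpace d} {data : Fin m → Fin n → Ω → X}
    {label : Fin m → Ω → Fin n → Bool} {ℓ : ParamSpace d → X → ℝ} {L σ₀ : ℝ}
    (h : SplitSampling μ P G θ data label) (hℓ : RegularLoss ℓ P L σ₀) (hS : S ⊆ G)
    (hn : 0 < n / 2) {t : ℝ} (ht : 0 < t) {N : ℕ} (hN : S.card ≤ N) {η q c : ℝ} (hη : 0 ≤ η)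
    (hq : σ₀ ^ 2 / ((n / 2 : ℕ) * t ^ 2) ≤ q) (hq0 : 0 < q) (hq1 : q ≤ 1)
    (hqc : 2 * q ^ η ≤ Real.exp (-c)) :
    μ {ω | η * N < ((S.filter fun j => t < ‖batchGrad ℓ (θ j ω) (fun u => data j u ω) (label j ω)
        - meanGrad ℓ P (θ j ω)‖).card : ℝ)}
      ≤ ENNReal.ofReal (min (N * q) (Real.exp (-c * N))) := by
  set bad : Fin m → Ω → Prop := fun j ω =>
    t < ‖batchGrad ℓ (θ j ω) (fun u => data j u ω) (label j ω) - meanGrad ℓ P (θ j ω)‖ with hbad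
  have hjoint : ∀ T ⊆ S, μ {ω | ∀ j ∈ T, bad j ω} ≤ ENNReal.ofReal (q ^ T.card) := by
    intro T hT
    rw [ENNReal.ofReal_pow hq0.le]
    refine (h.measure_forall_batchGrad_gt_le hℓ (hT.trans hS) hn ht).trans ?_
    gcongr
  have hN' : (S.card : ℝ) ≤ N := by exact_mod_cast hN
  rcases min_choice ((N : ℝ) * q) (Real.exp (-c * N)) with hmin | hmin <;> rw [hmin]
  · calc μ {ω | η * N < ((S.filter fun j => bad j ω).card : ℝ)}
        ≤ μ (⋃ j ∈ S, {ω | ∀ j' ∈ ({j} : Finset (Fin m)), bad j' ω}) := by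
          refine measure_mono fun ω hω => ?_
          have hpos : (0 : ℝ) < ((S.filter fun j => bad j ω).card : ℝ) :=
            (mul_nonneg hη (Nat.cast_nonneg N)).trans_lt hω
          obtain ⟨j, hj⟩ := Finset.card_pos.1 (Nat.cast_pos.1 hpos)
          rw [Finset.mem_filter] at hj
          refine Set.mem_biUnion hj.1 fun j' hj' => ?_
          rw [Finset.mem_singleton.1 hj']
          exact hj.2
      _ ≤ ∑ j ∈ S, μ {ω | ∀ j' ∈ ({j} : Finset (Fin m)), bad j' ω} :=
          measure_biUnion_finset_le _ _
      _ ≤ ∑ _j ∈ S, ENNReal.ofReal q := Finset.sum_le_sum fun j hj => by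
          simpa using hjoint {j} (Finset.singleton_subset_iff.2 hj)
      _ = ENNReal.ofReal (S.card * q) := by
          rw [Finset.sum_const, ENNReal.ofReal_mul (Nat.cast_nonneg _), ENNReal.ofReal_natCast,
            nsmul_eq_mul]
      _ ≤ ENNReal.ofReal (N * q) := by gcongr
  · calc μ {ω | η * N < ((S.filter fun j => bad j ω).card : ℝ)}
        ≤ μ (⋃ T ∈ S.powerset.filter (fun T => η * N < (T.card : ℝ)),
            {ω | ∀ j ∈ T, bad j ω}) := by
          refine measure_mono fun ω hω => ?_
          refine Set.mem_biUnion (x := S.filter fun j => bad j ω) ?_ fun j hj =>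
            (Finset.mem_filter.1 hj).2
          exact Finset.mem_filter.2 ⟨Finset.mem_powerset.2 (Finset.filter_subset _ _), hω⟩
      _ ≤ ∑ T ∈ S.powerset.filter (fun T => η * N < (T.card : ℝ)),
            μ {ω | ∀ j ∈ T, bad j ω} := measure_biUnion_finset_le _ _
      _ ≤ ∑ _T ∈ S.powerset.filter (fun T => η * N < (T.card : ℝ)),
            ENNReal.ofReal (q ^ (η * N)) := by
          refine Finset.sum_le_sum fun T hT => ?_
          rw [Finset.mem_filter, Finset.mem_powerset] at hT
          refine (hjoint T hT.1).trans (ENNReal.ofReal_le_ofReal ?_)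
          rw [← Real.rpow_natCast]
          exact Real.rpow_le_rpow_of_exponent_ge hq0 hq1 hT.2.le
      _ = ENNReal.ofReal ((S.powerset.filter (fun T => η * N < (T.card : ℝ))).card
            * q ^ (η * N)) := by
          rw [Finset.sum_const, ENNReal.ofReal_mul (Nat.cast_nonneg _), ENNReal.ofReal_natCast,
            nsmul_eq_mul]
      _ ≤ ENNReal.ofReal (Real.exp (-c * N)) := by
          refine ENNReal.ofReal_le_ofReal ?_
          have hcard : ((S.powerset.filter (fun T => η * N < (T.card : ℝ))).card : ℝ)
              ≤ 2 ^ N := by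
            have : (S.powerset.filter (fun T => η * N < (T.card : ℝ))).card ≤ 2 ^ N := by
              refine (Finset.card_filter_le _ _).trans ?_
              rw [Finset.card_powerset]
              exact Nat.pow_le_pow_right two_pos hN
            exact_mod_cast this
          calc _ ≤ (2 : ℝ) ^ N * q ^ (η * N) := by gcongr
            _ = (2 * q ^ η) ^ N := by rw [Real.rpow_mul hq0.le, Real.rpow_natCast, mul_pow]
            _ ≤ Real.exp (-c) ^ N := by gcongr
            _ = Real.exp (-c * N) := by rw [← Real.exp_nat_mul, mul_comm]

/-! ### The deviation of the robust means -/

theorem self_mem_nbhd {m : ℕ} (Γ : SimpleGraph (Fin m)) (j : Fin m) : j ∈ nbhd Γ j := by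
  simp [nbhd]

theorem normalNbhd_subset {m : ℕ} (Γ : SimpleGraph (Fin m)) (G : Finset (Fin m)) (j : Fin m) :
    normalNbhd Γ G j ⊆ G :=
  fun _ hk => (Finset.mem_filter.1 hk).2

theorem card_normalNbhd_add_card_byzNbhd {m : ℕ} (Γ : SimpleGraph (Fin m)) (G : Finset (Fin m))
    (j : Fin m) : (normalNbhd Γ G j).card + (byzNbhd Γ G j).card = (nbhd Γ j).card :=
  Finset.card_filter_add_card_filter_not _

/-- Parameters with small total squared deviation from their average are close to each other. -/
theorem norm_sub_le_of_sum_sq_le {d m : ℕ} {G : Finset (Fin m)} {θ : Fin m → ParamSpace d}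
    {v : ParamSpace d} {B : ℝ} (hB : ∑ j ∈ G, ‖θ j - v‖ ^ 2 ≤ B) {j k : Fin m} (hj : j ∈ G)
    (hk : k ∈ G) : ‖θ j - θ k‖ ≤ 2 * √B := by
  have key : ∀ j ∈ G, ‖θ j - v‖ ≤ √B := fun j hj => Real.le_sqrt_of_sq_le <|
    (Finset.single_le_sum (f := fun j => ‖θ j - v‖ ^ 2) (fun _ _ => sq_nonneg _) hj).trans hB
  calc ‖θ j - θ k‖ ≤ ‖θ j - v‖ + ‖v - θ k‖ := norm_sub_le_norm_sub_add_norm_sub _ _ _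
    _ ≤ 2 * √B := by rw [norm_sub_rev v]; linarith [key j hj, key k hk]

open Classical in
/-- If few normal neighbours have deviating messages, then the robust mean is accurate. -/
theorem RobustEstimator.IsOutput.norm_sub_meanGrad_le {est : RobustEstimator} {d m : ℕ}
    {X : Type*} [MeasurableSpace X] {ℓ : ParamSpace d → X → ℝ} {P : Measure X}
    [IsProbabilityMeasure P] {L σ₀ : ℝ} (hℓ : RegularLoss ℓ P L σ₀) {Γ : SimpleGraph (Fin m)}
    {G : Finset (Fin m)} {j : Fin m} (hj : j ∈ G) {θ msg : Fin m → ParamSpace d}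
    {g v : ParamSpace d} {ε₀ ε t B : ℝ} (ht : 0 ≤ t) (hε : ε < 1 / 2)
    (hB : ∑ j ∈ G, ‖θ j - v‖ ^ 2 ≤ B)
    (hbyz : ((byzNbhd Γ G j).card : ℝ) ≤ ε₀ * ((nbhd Γ j).card : ℝ))
    (hbad : (((normalNbhd Γ G j).filter fun k => t < ‖msg k - meanGrad ℓ P (θ k)‖).card : ℝ)
      ≤ (ε - ε₀) * ((nbhd Γ j).card : ℝ))
    (hg : est.IsOutput ε (nbhd Γ j) msg g) :
    ‖g - meanGrad ℓ P (θ j)‖ ≤ robustFactor d ε * (t + |L| * (2 * √B)) := by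
  -- `H` omits at most `ε₀|N_j|` Byzantine and `(ε - ε₀)|N_j|` deviating nodes, hence at most
  -- `ε|N_j|`.
  set H := (normalNbhd Γ G j).filter fun k => ¬ t < ‖msg k - meanGrad ℓ P (θ k)‖ with hHdef
  refine hg.norm_sub_le (H := H) (by positivity) hε
    ((Finset.filter_subset _ _).trans (Finset.filter_subset _ _)) ⟨j, self_mem_nbhd Γ j⟩ ?_ ?_
  · have h1 : (((normalNbhd Γ G j).filter fun k => t < ‖msg k - meanGrad ℓ P (θ k)‖).card : ℝ)
        + H.card = (normalNbhd Γ G j).card := by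
      exact_mod_cast Finset.card_filter_add_card_filter_not
        (s := normalNbhd Γ G j) (fun k => t < ‖msg k - meanGrad ℓ P (θ k)‖)
    have h2 : ((normalNbhd Γ G j).card : ℝ) + (byzNbhd Γ G j).card = (nbhd Γ j).card := by
      exact_mod_cast card_normalNbhd_add_card_byzNbhd Γ G j
    linarith
  · intro k hk
    rw [hHdef, Finset.mem_filter, not_lt] at hk
    calc ‖msg k - meanGrad ℓ P (θ j)‖
        ≤ ‖msg k - meanGrad ℓ P (θ k)‖ + ‖meanGrad ℓ P (θ k) - meanGrad ℓ P (θ j)‖ :=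
          norm_sub_le_norm_sub_add_norm_sub _ _ _
      _ ≤ t + |L| * ‖θ k - θ j‖ := add_le_add hk.2 (hℓ.norm_meanGrad_sub_le _ _)
      _ ≤ t + |L| * (2 * √B) := by
          gcongr
          exact norm_sub_le_of_sum_sq_le hB (normalNbhd_subset Γ G j hk.1) hj

/-- The failure probability of the robust means at a fixed accuracy. -/
theorem SplitSampling.measure_deviation_le {est : RobustEstimator} {d m n k₀ : ℕ} {Ω X : Type*}
    [MeasurableSpace Ω] [MeasurableSpace X] {μ : Measure Ω} [IsProbabilityMeasure μ]
    {P : Measure X} [IsProbabilityMeasure P] {Γ : SimpleGraph (Fin m)} {G : Finset (Fin m)}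
    {i : Fin m} {θ msg ghat : Fin m → Ω → ParamSpace d} {data : Fin m → Fin n → Ω → X}
    {label : Fin m → Ω → Fin n → Bool} {ℓ : ParamSpace d → X → ℝ}
    {L σ₀ Cw δ ε₀ ε c τ q t : ℝ} (hε : ε₀ ≤ ε) (hε₁ : ε < 1 / 2)
    (hℓ : RegularLoss ℓ P L σ₀)
    (hbyz : ∀ j ∈ normalNbhd Γ G i, ((byzNbhd Γ G j).card : ℝ) ≤ ε₀ * ((nbhd Γ j).card : ℝ))
    (hwarm : WarmUpCondition μ G θ k₀ Cw δ τ)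
    (h : SplitSampling μ P G θ data label)
    (hmsg : ∀ j ∈ G, ∀ ω, msg j ω = batchGrad ℓ (θ j ω) (fun u => data j u ω) (label j ω))
    (hghat : ∀ j ∈ normalNbhd Γ G i, ∀ ω,
      est.IsOutput ε (nbhd Γ j) (fun j' => msg j' ω) (ghat j ω))
    (hn : 0 < n / 2) (ht : 0 < t) (hq : σ₀ ^ 2 / ((n / 2 : ℕ) * t ^ 2) ≤ q) (hq0 : 0 < q)
    (hq1 : q ≤ 1) (hqc : 2 * q ^ (ε - ε₀) ≤ Real.exp (-c)) :
    μ {ω | ¬ ∀ j ∈ normalNbhd Γ G i, ‖ghat j ω - meanGrad ℓ P (θ j ω)‖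
        ≤ robustFactor d ε * (t + |L| * (2 * √(Cw / (k₀ : ℝ) ^ (1 - δ))))}
      ≤ ENNReal.ofReal τ + ENNReal.ofReal (∑ j ∈ normalNbhd Γ G i,
          min ((nbhd Γ j).card * q) (Real.exp (-c * (nbhd Γ j).card))) := by
  classical
  set bad : Fin m → Set Ω := fun j => {ω | (ε - ε₀) * ((nbhd Γ j).card : ℝ) <
    (((normalNbhd Γ G j).filter fun k => t < ‖batchGrad ℓ (θ k ω) (fun u => data k u ω)
      (label k ω) - meanGrad ℓ P (θ k ω)‖).card : ℝ)} with hbad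
  calc _ ≤ μ ({ω | ¬ ∑ j ∈ G, ‖θ j ω - normalAverage G (fun i => θ i ω)‖ ^ 2
          ≤ Cw / (k₀ : ℝ) ^ (1 - δ)} ∪ ⋃ j ∈ normalNbhd Γ G i, bad j) := by
        refine measure_mono fun ω hω => ?_
        by_contra hcon
        rw [Set.mem_union, not_or] at hcon
        refine hω fun j hj => ?_
        have hjbad : ω ∉ bad j := fun hmem => hcon.2 (Set.mem_biUnion hj hmem)
        refine (hghat j hj ω).norm_sub_meanGrad_le hℓ (θ := fun j => θ j ω)
          (normalNbhd_subset Γ G i hj) ht.le hε₁ (not_not.1 hcon.1) (hbyz j hj) ?_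
        refine le_of_eq_of_le ?_ (not_lt.1 hjbad)
        congr 2
        refine Finset.filter_congr fun k hk => ?_
        rw [hmsg k (normalNbhd_subset Γ G j hk)]
    _ ≤ ENNReal.ofReal τ + ∑ j ∈ normalNbhd Γ G i, μ (bad j) :=
        (measure_union_le _ _).trans (add_le_add hwarm (measure_biUnion_finset_le _ _))
    _ ≤ _ := by
        rw [ENNReal.ofReal_sum_of_nonneg fun j _ => le_min (by positivity) (Real.exp_pos _).le]
        gcongr with j hj
        exact h.measure_card_batchGrad_gt_le hℓ (normalNbhd_subset Γ G j) hn ht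
          (Finset.card_filter_le _ _) (by linarith) hq hq0 hq1 hqc

/-! ### Rates -/

/-- The squared noise level of the messages that is tolerated. -/
noncomputable def noiseLevel (ρ : ℕ → ℕ → ℝ) (n m : ℕ) : ℝ :=
  √|ρ n m| + (√(n : ℝ))⁻¹

theorem noiseLevel_nonneg (ρ : ℕ → ℕ → ℝ) (n m : ℕ) : 0 ≤ noiseLevel ρ n m := by
  unfold noiseLevel; positivity

theorem noiseLevel_pos (ρ : ℕ → ℕ → ℝ) {n : ℕ} (hn : 0 < n) (m : ℕ) : 0 < noiseLevel ρ n m := by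
  have : (0 : ℝ) < n := by exact_mod_cast hn
  unfold noiseLevel; positivity

theorem tendsto_noiseLevel {ρ : ℕ → ℕ → ℝ}
    (hρ : Tendsto (fun p : ℕ × ℕ => ρ p.1 p.2) (atTop ×ˢ atTop) (𝓝 0)) :
    Tendsto (fun p : ℕ × ℕ => noiseLevel ρ p.1 p.2) (atTop ×ˢ atTop) (𝓝 0) := by
  have h1 : Tendsto (fun p : ℕ × ℕ => √|ρ p.1 p.2|) (atTop ×ˢ atTop) (𝓝 0) := by
    simpa using hρ.abs.sqrt
  have h2 : Tendsto (fun p : ℕ × ℕ => (√(p.1 : ℝ))⁻¹) (atTop ×ˢ atTop) (𝓝 0) :=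
    (tendsto_inv_atTop_zero.comp
      (Real.tendsto_sqrt_atTop.comp tendsto_natCast_atTop_atTop)).comp tendsto_fst
  simpa [noiseLevel] using h1.add h2

/-- The summand `1/√n` of the noise level gives `n s ≥ √n`. -/
theorem tendsto_div_mul_noiseLevel (A : ℝ) (ρ : ℕ → ℕ → ℝ) (hA : 0 ≤ A) :
    Tendsto (fun p : ℕ × ℕ => A / (p.1 * noiseLevel ρ p.1 p.2)) (atTop ×ˢ atTop) (𝓝 0) := by
  have h2 : Tendsto (fun p : ℕ × ℕ => A * (√(p.1 : ℝ))⁻¹) (atTop ×ˢ atTop) (𝓝 0) := by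
    simpa using ((tendsto_inv_atTop_zero.comp
      (Real.tendsto_sqrt_atTop.comp tendsto_natCast_atTop_atTop)).comp
        (tendsto_fst (f := (atTop : Filter ℕ)) (g := (atTop : Filter ℕ)))).const_mul A
  refine squeeze_zero' (Eventually.of_forall fun p => ?_) ?_ h2
  · have := noiseLevel_nonneg ρ p.1 p.2
    positivity
  · filter_upwards [tendsto_fst.eventually (eventually_gt_atTop 0)] with p hp
    have hp' : (0 : ℝ) < p.1 := by exact_mod_cast hp
    have hs : √(p.1 : ℝ) ≤ p.1 * noiseLevel ρ p.1 p.2 := by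
      calc √(p.1 : ℝ) = p.1 * (√(p.1 : ℝ))⁻¹ := by
            rw [← div_eq_mul_inv, Real.div_sqrt]
        _ ≤ p.1 * noiseLevel ρ p.1 p.2 := by
            gcongr
            exact le_add_of_nonneg_left (Real.sqrt_nonneg _)
    rw [div_eq_mul_inv]
    have := Real.sqrt_pos.2 hp'
    gcongr

/-- The summand `√|ρ|` of the noise level gives `|ρ| / s ≤ √|ρ|`. -/
theorem tendsto_div_noiseLevel_mul {ρ : ℕ → ℕ → ℝ}
    (hρ : Tendsto (fun p : ℕ × ℕ => ρ p.1 p.2) (atTop ×ˢ atTop) (𝓝 0)) {A : ℝ} (hA : 0 ≤ A) :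
    Tendsto (fun p : ℕ × ℕ => A / noiseLevel ρ p.1 p.2 * |ρ p.1 p.2|) (atTop ×ˢ atTop)
      (𝓝 0) := by
  have h1 : Tendsto (fun p : ℕ × ℕ => A * √|ρ p.1 p.2|) (atTop ×ˢ atTop) (𝓝 0) := by
    simpa using hρ.abs.sqrt.const_mul A
  refine squeeze_zero (fun p => ?_) (fun p => ?_) h1
  · have := noiseLevel_nonneg ρ p.1 p.2
    positivity
  · have hle : √|ρ p.1 p.2| ≤ noiseLevel ρ p.1 p.2 :=
      le_add_of_nonneg_right (by positivity)
    rw [div_mul_eq_mul_div]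
    refine div_le_of_le_mul₀ (noiseLevel_nonneg _ _ _) (by positivity) ?_
    calc A * |ρ p.1 p.2| = A * √|ρ p.1 p.2| * √|ρ p.1 p.2| := by
          rw [mul_assoc, Real.mul_self_sqrt (abs_nonneg _)]
      _ ≤ A * √|ρ p.1 p.2| * noiseLevel ρ p.1 p.2 := by gcongr

theorem tendsto_sqrt_div_rpow (Cw : ℝ) {δ : ℝ} (hδ : δ < 1) :
    Tendsto (fun k : ℕ => √(Cw / (k : ℝ) ^ (1 - δ))) atTop (𝓝 0) := by
  have h1 : Tendsto (fun k : ℕ => Cw / (k : ℝ) ^ (1 - δ)) atTop (𝓝 0) :=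
    ((tendsto_rpow_atTop (sub_pos.2 hδ)).comp tendsto_natCast_atTop_atTop).const_div_atTop Cw
  simpa using h1.sqrt

/-! ### Choice of the rates and conclusion -/

/-- Sizes for which the failure probability is controlled. -/
structure LargeSizes (A c η : ℝ) (ρ : ℕ → ℕ → ℝ) (n m : ℕ) : Prop where
  two_le : 2 ≤ n
  noise_le : noiseLevel ρ n m ≤ A
  prob_le : A / (n * noiseLevel ρ n m) ≤ 1
  exp_le : 2 * (A / (n * noiseLevel ρ n m)) ^ η ≤ Real.exp (-c)

theorem eventually_largeSizes {A c η : ℝ} {ρ : ℕ → ℕ → ℝ} (hA : 0 < A) (hη : 0 < η)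
    (hρ : Tendsto (fun p : ℕ × ℕ => ρ p.1 p.2) (atTop ×ˢ atTop) (𝓝 0)) :
    ∀ᶠ p : ℕ × ℕ in atTop ×ˢ atTop, LargeSizes A c η ρ p.1 p.2 := by
  have hq := tendsto_div_mul_noiseLevel A ρ hA.le
  have hqη : Tendsto (fun p : ℕ × ℕ => 2 * (A / (p.1 * noiseLevel ρ p.1 p.2)) ^ η)
      (atTop ×ˢ atTop) (𝓝 0) := by
    simpa [Real.zero_rpow hη.ne'] using (hq.rpow_const (Or.inr hη.le)).const_mul 2
  filter_upwards [tendsto_fst.eventually (eventually_ge_atTop 2),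
    (tendsto_noiseLevel hρ).eventually_le_const hA, hq.eventually_le_const one_pos,
    hqη.eventually_le_const (Real.exp_pos (-c))] with p h1 h2 h3 h4
  exact ⟨h1, h2, h3, h4⟩

/-- The factor `3` absorbs rounding, as `⌊n/2⌋ ≥ n/3`; `v + 1` keeps the bound positive when the
variance bound `v` vanishes. -/
theorem div_half_mul_le {n : ℕ} (hn : 2 ≤ n) {v s : ℝ} (hv : 0 ≤ v) (hs : 0 < s) :
    v / ((n / 2 : ℕ) * s) ≤ 3 * (v + 1) / (n * s) := by
  have hn' : (0 : ℝ) < n := by exact_mod_cast (by omega : 0 < n)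
  have h3 : (n : ℝ) / 3 ≤ (n / 2 : ℕ) := by
    have : (n : ℝ) ≤ 3 * (n / 2 : ℕ) := by exact_mod_cast (by omega : n ≤ 3 * (n / 2))
    linarith
  calc v / ((n / 2 : ℕ) * s) ≤ (v + 1) / (n / 3 * s) := by
        gcongr
        linarith
    _ = 3 * (v + 1) / (n * s) := by field_simp

/-- Since `K ≥ 1`, it may be inserted in the exponential argument too and then pulled out of the
minimum. -/
theorem sum_min_le_mul {ι : Type*} (S : Finset ι) (N : ι → ℝ) {n c K ρ : ℝ} (hK : 1 ≤ K)
    (h : ∑ j ∈ S, min (N j / n) (Real.exp (-c * N j)) ≤ ρ) :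
    ∑ j ∈ S, min (N j * (K / n)) (Real.exp (-c * N j)) ≤ K * |ρ| := by
  calc ∑ j ∈ S, min (N j * (K / n)) (Real.exp (-c * N j))
      ≤ ∑ j ∈ S, K * min (N j / n) (Real.exp (-c * N j)) := by
        refine Finset.sum_le_sum fun j _ => ?_
        rw [mul_min_of_nonneg _ _ (by linarith : (0 : ℝ) ≤ K)]
        refine min_le_min (le_of_eq (by ring)) ?_
        exact le_mul_of_one_le_left (Real.exp_pos _).le hK
    _ = K * ∑ j ∈ S, min (N j / n) (Real.exp (-c * N j)) := by rw [Finset.mul_sum]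
    _ ≤ K * |ρ| := by
        gcongr
        exact h.trans (le_abs_self ρ)

theorem proposition1 (est : RobustEstimator) (d : ℕ) (L σ₀ Cw δ ε₀ ε c : ℝ)
    (τw : ℕ → ℝ) (ρ : ℕ → ℕ → ℝ)
    (hδ₀ : 0 < δ) (hδ₁ : δ < 1) (hε₀ : 0 ≤ ε₀) (hε : ε₀ < ε) (hε₁ : ε < 1 / 2) (hc : 0 < c)
    (hτw : Tendsto τw atTop (𝓝 0))
    (hρ : Tendsto (fun p : ℕ × ℕ => ρ p.1 p.2) (atTop ×ˢ atTop) (𝓝 0)) :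
    ∃ (C : ℝ) (δg τg : ℕ → ℕ → ℕ → ℝ), 0 < C ∧
      Tendsto (fun p : ℕ × ℕ × ℕ => δg p.1 p.2.1 p.2.2) (atTop ×ˢ atTop ×ˢ atTop) (𝓝 0) ∧
      Tendsto (fun p : ℕ × ℕ × ℕ => τg p.1 p.2.1 p.2.2) (atTop ×ˢ atTop ×ˢ atTop) (𝓝 0) ∧
      ∀ (n m k₀ : ℕ), 0 < k₀ →
      ∀ (Ω X : Type*) [MeasurableSpace Ω] [MeasurableSpace X]
        (μ : Measure Ω) [IsProbabilityMeasure μ] (P : Measure X) [IsProbabilityMeasure P]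
        (ℓ : ParamSpace d → X → ℝ)
        (Γ : SimpleGraph (Fin m)) (G : Finset (Fin m)) (i : Fin m)
        (θ : Fin m → Ω → ParamSpace d)
        (data : Fin m → Fin n → Ω → X) (label : Fin m → Ω → Fin n → Bool)
        (msg ghat : Fin m → Ω → ParamSpace d),
        RegularLoss ℓ P L σ₀ →
        i ∈ G →
        -- the Byzantine fraction in each of the neighbourhoods involved
        (∀ j ∈ normalNbhd Γ G i, ((byzNbhd Γ G j).card : ℝ) ≤ ε₀ * ((nbhd Γ j).card : ℝ)) →
        -- neighbourhood sizes versus the number of samples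
        ∑ j ∈ normalNbhd Γ G i,
            min (((nbhd Γ j).card : ℝ) / n) (Real.exp (-c * ((nbhd Γ j).card : ℝ))) ≤ ρ n m →
        WarmUpCondition μ G θ k₀ Cw δ (τw k₀) →
        SplitSampling μ P G θ data label →
        -- normal nodes send their first-half gradients, Byzantine nodes send anything
        (∀ j ∈ G, ∀ ω, msg j ω = batchGrad ℓ (θ j ω) (fun u => data j u ω) (label j ω)) →
        (∀ j ∈ normalNbhd Γ G i, ∀ ω,
          est.IsOutput ε (nbhd Γ j) (fun j' => msg j' ω) (ghat j ω)) →
        μ {ω | ¬ ∀ j ∈ normalNbhd Γ G i,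
            ‖ghat j ω - meanGrad ℓ P (θ j ω)‖ ≤ C * δg n m k₀} ≤ ENNReal.ofReal (τg n m k₀) := by
  classical
  set A : ℝ := 3 * (σ₀ ^ 2 + 1) with hAdef
  have hA : 0 < A := by positivity
  have hpair : Tendsto (fun p : ℕ × ℕ × ℕ => (p.1, p.2.1)) (atTop ×ˢ atTop ×ˢ atTop)
      ((atTop : Filter ℕ) ×ˢ (atTop : Filter ℕ)) :=
    tendsto_fst.prodMk (tendsto_fst.comp tendsto_snd)
  have hlast : Tendsto (fun p : ℕ × ℕ × ℕ => p.2.2)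
      ((atTop : Filter ℕ) ×ˢ (atTop : Filter ℕ) ×ˢ (atTop : Filter ℕ)) atTop :=
    tendsto_snd.comp tendsto_snd
  -- The first summand of the accuracy is the threshold `t = √s`, the second the spread of the
  -- population gradients. Where the sizes are not large, the failure bound is the trivial `1`,
  -- which does not affect the limit.
  refine ⟨robustFactor d ε,
    fun n m k => √(noiseLevel ρ n m) + |L| * (2 * √(Cw / (k : ℝ) ^ (1 - δ))),
    fun n m k => if LargeSizes A c (ε - ε₀) ρ n m then
      |τw k| + A / noiseLevel ρ n m * |ρ n m| else 1, robustFactor_pos d ε, ?_, ?_, ?_⟩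
  · have h1 := ((tendsto_noiseLevel hρ).comp hpair).sqrt
    have h2 := (((tendsto_sqrt_div_rpow Cw hδ₁).comp hlast).const_mul 2).const_mul |L|
    simpa using h1.add h2
  · have h1 := (hτw.comp hlast).abs
    have h2 := (tendsto_div_noiseLevel_mul hρ hA.le).comp hpair
    have h3 := h1.add h2
    rw [abs_zero, add_zero] at h3
    refine h3.congr' ?_
    filter_upwards [hpair.eventually (eventually_largeSizes hA (sub_pos.2 hε) hρ)] with p hp
    exact (if_pos hp).symm
  · intro n m k₀ _ Ω X _ _ μ _ P _ ℓ Γ G i θ data label msg ghat hℓ _ hbyz hsizes hwarm hsamp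
      hmsg hghat
    by_cases hlarge : LargeSizes A c (ε - ε₀) ρ n m
    · have hnpos : 0 < n := by have := hlarge.two_le; omega
      have hnpos' : (0 : ℝ) < n := by exact_mod_cast hnpos
      have hs := noiseLevel_pos ρ hnpos m
      -- Here `q = K / n` with `K = A / s`, which matches the minimum in the size hypothesis up to
      -- the factor `K`.
      have hK : 1 ≤ A / noiseLevel ρ n m := (one_le_div hs).2 hlarge.noise_le
      have hq : σ₀ ^ 2 / ((n / 2 : ℕ) * √(noiseLevel ρ n m) ^ 2)
          ≤ A / (n * noiseLevel ρ n m) := by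
        rw [Real.sq_sqrt hs.le]
        exact div_half_mul_le hlarge.two_le (sq_nonneg σ₀) hs
      refine (hsamp.measure_deviation_le hε.le hε₁ hℓ hbyz hwarm hmsg hghat
        (Nat.div_pos hlarge.two_le two_pos) (Real.sqrt_pos.2 hs) hq (by positivity)
        hlarge.prob_le hlarge.exp_le).trans ?_
      beta_reduce
      rw [if_pos hlarge, ENNReal.ofReal_add (abs_nonneg _) (by positivity)]
      refine add_le_add (ENNReal.ofReal_le_ofReal (le_abs_self _))
        (ENNReal.ofReal_le_ofReal ?_)
      have := sum_min_le_mul (normalNbhd Γ G i) (fun j => ((nbhd Γ j).card : ℝ)) hK hsizes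
      rwa [div_div, mul_comm (noiseLevel ρ n m)] at this
    · beta_reduce
      rw [if_neg hlarge, ENNReal.ofReal_one]
      exact prob_le_one
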